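/- Corollary 4.11 (label closures). Let $n\ge 2$. A *dH pencil* is a real $n\times n$ matrix pencil $L(\lambda)=\lambda E-(J-R)$ with $J^\top=-J$ and with $E$, $R$ symmetric positive semidefinite; let $\mathcal L$ be the set of all of them, with the topology of the coefficients. A pencil $\lambda E-A$ is *regular* if $\det(\lambda_0E-A)\neq 0$ for some $\lambda_0\in\mathbb C$, and *singular* otherwise; its *index* is the size of the largest block $\lambda\mathcal J_\sigma(0)-I_\sigma$ in its Kronecker canonical form ($0$ if there is no such block), where $\mathcal J_\sigma(0)$ is the nilpotent Jordan block of size $\sigma$. For a real $n\times n$ pencil $\Delta(\lambda)=X_0+\lambda X_1$ put $\|\Delta\|_F=(\|X_0\|_F^2+\|X_1\|_F^2)^{1/2}$ (Frobenius norms), and for $L\in\mathcal L$ let $$d_{\mathrm{sing}}(L)=\inf\{\|\Delta\|_F : L+\Delta\in\mathcal L\text{ is singular}\},\qquad d_{\mathrm{hi}}(L)=\inf\{\|\Delta\|_F : L+\Delta\in\mathcal L\text{ has index}\ge 2\}.$$ Then for all real $n\times n$ matrices $J=-J^\top$ and symmetric positive semidefinite $E$, $R$, with $L(\lambda)=\lambda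 E-(J-R)$, $$2\,\lambda_{\min}(-J^2)+d_{\mathrm{hi}}(L)^2\;\le\; d_{\mathrm{sing}}(L)^2\;\le\; 2\|J\|^2+d_{\mathrm{hi}}(L)^2,$$ where $\lambda_{\min}$ denotes the smallest eigenvalue and $\|J\|$ the spectral norm. In particular, the set of singular dH pencils is contained in the closure of the set of regular dH pencils of index two. -/

import Mathlib

namespace DHPencil

/-- A real `n × n` matrix pencil. The pair `(E, A)` stands for `λ E - A`; the space of pencils
carries the usual topology of `ℝ^{n×n} × ℝ^{n×n}`. -/
abbrev Pencil (n : ℕ) : Type :=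
  Matrix (Fin n) (Fin n) ℝ × Matrix (Fin n) (Fin n) ℝ

/-- The class of dissipative Hamiltonian (dH) pencils `λ E - (J - R)` with `E, R` symmetric
positive semidefinite and `J` skew-symmetric. -/
def dH (n : ℕ) : Set (Pencil n) :=
  {L | ∃ E J R : Matrix (Fin n) (Fin n) ℝ,
    E.PosSemidef ∧ J.transpose = -J ∧ R.PosSemidef ∧ L = (E, J - R)}

/-- `λ E - A` is regular if `det (z E - A) ≠ 0` for some complex number `z`. -/
def IsRegular {n : ℕ} (L : Pencil n) : Prop :=
  ∃ z : ℂ, (z • L.1.map Complex.ofReal - L.2.map Complex.ofReal).det ≠ 0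

/-- A (square) pencil is singular if it is not regular. -/
def IsSingular {n : ℕ} (L : Pencil n) : Prop := ¬ IsRegular L

/-- The upper triangular nilpotent Jordan block `𝒥_σ(0)`. -/
def nilpotentBlock (σ : ℕ) : Matrix (Fin σ) (Fin σ) ℝ :=
  Matrix.of fun i j => if (i : ℕ) + 1 = (j : ℕ) then 1 else 0

/-- `λ E - A` has the Kronecker block `𝒩_σ = λ 𝒥_σ(0) - I_σ` (a block of size `σ` of the
eigenvalue `∞`): for nonsingular real `S`, `T`, the pencil `S (λ E - A) T` is, up to a numbering
of rows and columns, `diag (λ E' - A', λ 𝒥_σ(0) - I_σ)`. Since the complementary pencil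
`λ E' - A'` has a Kronecker form of its own, and the Kronecker form is unique up to the order of
the blocks, the largest such `σ` is the size of the largest block at `∞` of the Kronecker form. -/
def HasInfinityBlock {n : ℕ} (L : Pencil n) (σ : ℕ) : Prop :=
  ∃ (m : ℕ) (e : Fin m ⊕ Fin σ ≃ Fin n) (S T : Matrix (Fin n) (Fin n) ℝ)
    (E' A' : Matrix (Fin m) (Fin m) ℝ),
    IsUnit S.det ∧ IsUnit T.det ∧
    (S * L.1 * T).submatrix e e = Matrix.fromBlocks E' 0 0 (nilpotentBlock σ) ∧
    (S * L.2 * T).submatrix e e = Matrix.fromBlocks A' 0 0 1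

theorem HasInfinityBlock.le {n σ : ℕ} {L : Pencil n} (h : HasInfinityBlock L σ) : σ ≤ n := by
  obtain ⟨m, e, -⟩ := h
  have := Fintype.card_congr e
  simp at this
  omega

/-- The index of a pencil: the size of its largest Kronecker block at `∞`, and `0` if there is
none (in particular if `E` is invertible). The set of sizes contains `0` and is bounded by `n`,
so that the supremum is a maximum. -/
noncomputable def index {n : ℕ} (L : Pencil n) : ℕ :=
  sSup {σ : ℕ | HasInfinityBlock L σ}

/-- The Frobenius norm `‖[X₀, X₁]‖_F` of the pencil `X₀ + λ X₁` (here `X₁ = D.1`,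
`X₀ = -D.2`). -/
noncomputable def frobNorm {n : ℕ} (D : Pencil n) : ℝ :=
  Real.sqrt (∑ i, ∑ j, D.1 i j ^ 2 + ∑ i, ∑ j, D.2 i j ^ 2)

/-- The structured distance to singularity: the infimum of `‖Δ‖_F` over all perturbations `Δ`
such that `L + Δ` is a singular dH pencil (`∞` if there is none). -/
noncomputable def distSing {n : ℕ} (L : Pencil n) : ENNReal :=
  ⨅ (D : Pencil n) (_ : L + D ∈ dH n ∧ IsSingular (L + D)), ENNReal.ofReal (frobNorm D)

/-- The structured distance to higher index: the infimum of `‖Δ‖_F` over all perturbations `Δ`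
such that `L + Δ` is a dH pencil of index at least two (`∞` if there is none). -/
noncomputable def distHighIndex {n : ℕ} (L : Pencil n) : ENNReal :=
  ⨅ (D : Pencil n) (_ : L + D ∈ dH n ∧ 2 ≤ index (L + D)), ENNReal.ofReal (frobNorm D)

/-- The smallest eigenvalue of a real symmetric matrix (of positive size). -/
noncomputable def lambdaMin {n : ℕ} (X : Matrix (Fin n) (Fin n) ℝ) : ℝ :=
  sInf (spectrum ℝ X)

/-- The spectral norm of a matrix: the operator norm for the Euclidean norm on `ℝⁿ`. -/
noncomputable def specNorm {n : ℕ} (X : Matrix (Fin n) (Fin n) ℝ) : ℝ :=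
  ‖Matrix.toEuclideanCLM (𝕜 := ℝ) (n := Fin n) X‖

end DHPencil

/-! Both conditions come down to common kernel vectors, because `J` drops out of real quadratic
forms. A singular dH pencil has a vector killed by `E`, `J` and `R`
(`exists_common_kernel_of_isSingular`). Index at least two forces a vector killed by `E` and `R`
alone (`exists_common_kernel_of_two_le_index`), and conversely every dH pencil with such a vector is
a limit of regular ones of index two (`mem_closure_of_common_kernel`). This already gives the
inclusion of sets.

Thus reaching the closure of higher index needs no change of `J`, and the two distances differ only
by the price of making `J` kill a unit vector `v`. The cheapest skew change is the rank-two matrix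
built from `v` and `Jv`, with squared Frobenius norm `2‖Jv‖²`, and `‖Jv‖²` lies between the smallest
eigenvalue of `-J²` and `‖J‖²`. Skew and symmetric parts are Frobenius-orthogonal, so the squared
costs add. -/

namespace DHPencil

open Matrix Filter Topology

/-! ### Quadratic forms and biorthogonal completion. -/

section LinearAlgebra

variable {n : ℕ}

theorem dotProduct_mulVec_comm (A : Matrix (Fin n) (Fin n) ℝ) (x y : Fin n → ℝ) :
    x ⬝ᵥ A *ᵥ y = y ⬝ᵥ Aᵀ *ᵥ x := by
  rw [mulVec_transpose, dotProduct_mulVec, dotProduct_comm]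

theorem dotProduct_mulVec_self_of_skew {J : Matrix (Fin n) (Fin n) ℝ} (hJ : Jᵀ = -J)
    (x : Fin n → ℝ) : x ⬝ᵥ J *ᵥ x = 0 := by
  have h := dotProduct_mulVec_comm J x x
  rw [hJ, neg_mulVec, dotProduct_neg] at h
  linarith

theorem transpose_eq_of_posSemidef {E : Matrix (Fin n) (Fin n) ℝ} (hE : E.PosSemidef) : Eᵀ = E := by
  simpa [IsHermitian, conjTranspose_eq_transpose_of_trivial] using hE.isHermitian

theorem quadForm_nonneg {E : Matrix (Fin n) (Fin n) ℝ} (hE : E.PosSemidef) (x : Fin n → ℝ) :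
    0 ≤ x ⬝ᵥ E *ᵥ x := by
  simpa using hE.dotProduct_mulVec_nonneg x

theorem mulVec_eq_zero_of_quadForm {E : Matrix (Fin n) (Fin n) ℝ} (hE : E.PosSemidef)
    {x : Fin n → ℝ} (h : x ⬝ᵥ E *ᵥ x = 0) : E *ᵥ x = 0 :=
  (hE.dotProduct_mulVec_zero_iff x).1 (by simpa using h)

theorem exists_unit_smul {x : Fin n → ℝ} (hx : x ≠ 0) :
    ∃ c : ℝ, (c • x) ⬝ᵥ (c • x) = 1 := by
  have h : 0 < x ⬝ᵥ x :=
    lt_of_le_of_ne (by simpa using dotProduct_star_self_nonneg x) fun h => hx (dotProduct_self_eq_zero.1 h.symm)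
  refine ⟨(Real.sqrt (x ⬝ᵥ x))⁻¹, ?_⟩
  have h2 := Real.mul_self_sqrt h.le
  have h3 := Real.sqrt_pos.2 h
  simp only [smul_dotProduct, dotProduct_smul, smul_eq_mul]
  field_simp
  nlinarith

/-- If `p` and `t` are biorthogonal, `t` can be completed to a basis by vectors orthogonal
to `p`. -/
theorem exists_completion {m k : ℕ} (e : Fin m ⊕ Fin k ≃ Fin n) (p t : Fin k → Fin n → ℝ)
    (h : ∀ i j, p i ⬝ᵥ t j = if i = j then 1 else 0) :
    ∃ T : Matrix (Fin n) (Fin n) ℝ, IsUnit T.det ∧ (∀ j, T.col (e (Sum.inr j)) = t j) ∧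
      ∀ i l, p i ⬝ᵥ T.col (e (Sum.inl l)) = 0 := by
  set φ : (Fin n → ℝ) →ₗ[ℝ] (Fin k → ℝ) := (Matrix.of p).mulVecLin with hφ
  have hφa : ∀ x i, φ x i = p i ⬝ᵥ x := fun x i => rfl
  have hsum : ∀ (c : Fin k → ℝ) i, p i ⬝ᵥ (∑ j, c j • t j) = c i := by
    intro c i
    simp [dotProduct_sum, h]
  have hsurj : LinearMap.range φ = ⊤ := by
    refine LinearMap.range_eq_top.2 fun c => ⟨∑ j, c j • t j, ?_⟩
    ext i
    rw [hφa, hsum]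
  have hcard : m + k = n := by simpa using Fintype.card_congr e
  have hker : Module.finrank ℝ (LinearMap.ker φ) = m := by
    have := LinearMap.finrank_range_add_finrank_ker φ
    rw [hsurj, finrank_top] at this
    simp at this
    omega
  -- The new columns are a basis of the joint kernel of the functionals `p i`, a complement of the
  -- span of `t` by biorthogonality.
  let b := Module.finBasisOfFinrankEq ℝ (LinearMap.ker φ) hker
  have hb : ∀ i l, p i ⬝ᵥ (b l : Fin n → ℝ) = 0 := fun i l => by
    rw [← hφa, LinearMap.mem_ker.1 (b l).2]; rfl
  let f : Fin m ⊕ Fin k → Fin n → ℝ := Sum.elim (fun l => (b l : Fin n → ℝ)) t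
  have hf : LinearIndependent ℝ f := by
    rw [Fintype.linearIndependent_iff]
    intro g hg
    rw [Fintype.sum_sum_type] at hg
    simp only [f, Sum.elim_inl, Sum.elim_inr] at hg
    have hr : ∀ i, g (Sum.inr i) = 0 := by
      intro i
      have := congrArg (fun x => p i ⬝ᵥ x) hg
      simpa [dotProduct_add, hsum (fun j => g (Sum.inr j)), dotProduct_sum (p i) Finset.univ
        (fun l => g (Sum.inl l) • (b l : Fin n → ℝ)), hb] using this
    have hl : ∀ l, g (Sum.inl l) = 0 := by
      have h0 : ∑ l, g (Sum.inl l) • b l = 0 := by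
        ext1
        simpa [hr] using hg
      exact Fintype.linearIndependent_iff.1 b.linearIndependent _ h0
    rintro (l | i)
    exacts [hl l, hr i]
  refine ⟨Matrix.of fun i j => f (e.symm j) i, ?_, ?_, ?_⟩
  · rw [← Matrix.isUnit_iff_isUnit_det, ← linearIndependent_cols_iff_isUnit]
    exact hf.comp e.symm e.symm.injective
  · intro j
    ext i
    simp [f]
  · intro i l
    have : (Matrix.of fun i j => f (e.symm j) i).col (e (Sum.inl l)) = (b l : Fin n → ℝ) := by
      ext i
      simp [f]
    rw [this, hb]

theorem mul_mul_apply_eq (S X T : Matrix (Fin n) (Fin n) ℝ) (i j : Fin n) :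
    (S * X * T) i j = S.row i ⬝ᵥ X *ᵥ T.col j := by
  rw [Matrix.mul_assoc, Matrix.mul_apply']
  congr 1

end LinearAlgebra

/-! ### Jordan chains at infinity and the index. -/

section InfinityBlock

variable {n : ℕ}

/-- Left and right Jordan chains of length two at infinity, normalised against each other,
split off a block of size two. -/
theorem hasInfinityBlock_two {E A : Matrix (Fin n) (Fin n) ℝ} (hn : 2 ≤ n)
    (s t : Fin 2 → Fin n → ℝ)
    (hst : ∀ i j, s i ⬝ᵥ A *ᵥ t j = if i = j then 1 else 0)
    (ht0 : E *ᵥ t 0 = 0) (ht1 : E *ᵥ t 1 = A *ᵥ t 0)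
    (hs1 : s 1 ᵥ* E = 0) (hs0 : s 0 ᵥ* E = s 1 ᵥ* A) :
    HasInfinityBlock (E, A) 2 := by
  let e : Fin (n - 2) ⊕ Fin 2 ≃ Fin n := finSumFinEquiv.trans (finCongr (by omega))
  -- Completing on both sides relative to the form of `A` makes the off-diagonal blocks of `A`
  -- vanish; the chain relations pass this on to `E`.
  obtain ⟨T, hT, hTt, hTp⟩ := exists_completion e (fun i => s i ᵥ* A) t
    (fun i j => by rw [← dotProduct_mulVec, hst])
  obtain ⟨S, hS, hSs, hSp⟩ := exists_completion e (fun i => A *ᵥ t i) s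
    (fun i j => by rw [dotProduct_comm, hst]; simp [eq_comm])
  have hrow : ∀ i, Sᵀ.row i = S.col i := fun i => rfl
  have hTp' : ∀ i l, s i ⬝ᵥ A *ᵥ T.col (e (Sum.inl l)) = 0 := fun i l => by
    rw [dotProduct_mulVec, hTp]
  have hSp' : ∀ i l, S.col (e (Sum.inl l)) ⬝ᵥ A *ᵥ t i = 0 := fun i l => by
    rw [dotProduct_comm, hSp]
  refine ⟨n - 2, e, Sᵀ, T, ((Sᵀ * E * T).submatrix e e).toBlocks₁₁,
    ((Sᵀ * A * T).submatrix e e).toBlocks₁₁, by rwa [det_transpose], hT, ?_, ?_⟩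
  · have h0 : ∀ x, s 0 ⬝ᵥ E *ᵥ x = s 1 ⬝ᵥ A *ᵥ x := fun x => by
      rw [dotProduct_mulVec, hs0, ← dotProduct_mulVec]
    have h1 : ∀ x, s 1 ⬝ᵥ E *ᵥ x = 0 := fun x => by
      rw [dotProduct_mulVec, hs1, zero_dotProduct]
    ext (i | i) (j | j)
    · rfl
    · simp only [submatrix_apply, mul_mul_apply_eq, hrow, hTt, fromBlocks_apply₁₂, Matrix.zero_apply]
      fin_cases j
      · simp [ht0]
      · simpa [ht1] using hSp' 0 i
    · simp only [submatrix_apply, mul_mul_apply_eq, hrow, hSs, fromBlocks_apply₂₁, Matrix.zero_apply]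
      fin_cases i
      · simpa [h0] using hTp' 1 j
      · simp [h1]
    · simp only [submatrix_apply, mul_mul_apply_eq, hrow, hSs, hTt, fromBlocks_apply₂₂]
      fin_cases i <;> fin_cases j <;> simp [h0, h1, hst, nilpotentBlock]
  · ext (i | i) (j | j)
    · rfl
    · simp only [submatrix_apply, mul_mul_apply_eq, hrow, hTt, fromBlocks_apply₁₂, Matrix.zero_apply]
      exact hSp' j i
    · simp only [submatrix_apply, mul_mul_apply_eq, hrow, hSs, fromBlocks_apply₂₁, Matrix.zero_apply]
      exact hTp' i j
    · simp only [submatrix_apply, mul_mul_apply_eq, hrow, hSs, hTt, fromBlocks_apply₂₂, hst,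
        one_apply]

/-- A block at infinity yields a right Jordan chain of nonzero vectors. -/
theorem HasInfinityBlock.exists_chain {E A : Matrix (Fin n) (Fin n) ℝ} {σ : ℕ}
    (h : HasInfinityBlock (E, A) σ) :
    ∃ t : Fin σ → Fin n → ℝ, (∀ j, t j ≠ 0) ∧ (∀ j, A *ᵥ t j ≠ 0) ∧
      (∀ j : Fin σ, (j : ℕ) = 0 → E *ᵥ t j = 0) ∧
      ∀ i j : Fin σ, (i : ℕ) + 1 = j → E *ᵥ t j = A *ᵥ t i := by
  obtain ⟨m, e, S, T, E', A', hS, hT, hE, hA⟩ := h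
  simp only at hE hA
  have hinj : ∀ x y, S *ᵥ x = S *ᵥ y → x = y := fun x y hxy =>
    mulVec_injective_of_isUnit ((isUnit_iff_isUnit_det _).2 hS) hxy
  have hcol : ∀ (X : Matrix (Fin n) (Fin n) ℝ) i j,
      (S *ᵥ X *ᵥ T.col j) i = (S * X * T) i j := by
    intro X i j
    rw [mul_mul_apply_eq, mulVec]
    rfl
  have hEe : ∀ a b, (S * E * T) (e a) (e b) = fromBlocks E' 0 0 (nilpotentBlock σ) a b :=
    fun a b => by rw [← hE]; rfl
  have hAe : ∀ a b, (S * A * T) (e a) (e b) = fromBlocks A' 0 0 1 a b :=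
    fun a b => by rw [← hA]; rfl
  have hAne : ∀ j, A *ᵥ T.col (e (Sum.inr j)) ≠ 0 := by
    intro j h0
    have := hcol A (e (Sum.inr j)) (e (Sum.inr j))
    rw [h0, hAe] at this
    simp at this
  refine ⟨fun j => T.col (e (Sum.inr j)), fun j h0 => hAne j (by simp only at h0; rw [h0, mulVec_zero]), hAne,
    ?_, ?_⟩
  · intro j hj
    refine hinj _ _ (funext fun i => ?_)
    obtain ⟨a, rfl⟩ := e.surjective i
    rw [hcol, hEe, mulVec_zero]
    rcases a with a | a
    · simp
    · simp [nilpotentBlock, hj]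
  · intro i j hij
    refine hinj _ _ (funext fun r => ?_)
    obtain ⟨a, rfl⟩ := e.surjective r
    rw [hcol, hEe, hcol, hAe]
    rcases a with a | a
    · simp
    · simp [nilpotentBlock, one_apply, ← hij, Fin.ext_iff]

/-- Positivity excludes the default value `sSup ∅ = 0`, so the supremum is attained. -/
theorem hasInfinityBlock_index {L : Pencil n} : 0 < index L → HasInfinityBlock L (index L) := by
  intro h
  have hb : BddAbove {σ : ℕ | HasInfinityBlock L σ} := ⟨n, fun σ hσ => hσ.le⟩
  have hne : {σ : ℕ | HasInfinityBlock L σ}.Nonempty := by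
    by_contra hne
    rw [Set.not_nonempty_iff_eq_empty] at hne
    simp [index, hne] at h
  exact Nat.sSup_mem hne hb

theorem HasInfinityBlock.le_index {L : Pencil n} {σ : ℕ} (h : HasInfinityBlock L σ) :
    σ ≤ index L :=
  le_csSup ⟨n, fun _ hσ => hσ.le⟩ h

end InfinityBlock

/-! ### Kernels, singularity and index of dH pencils. -/

section DissipativeHamiltonian

variable {n : ℕ} {E J R : Matrix (Fin n) (Fin n) ℝ}

/-- Pair the second chain relation with `t₀`: the `E` term vanishes by symmetry and the `J` term by
skewness, leaving the quadratic form of `R` at `t₀`. -/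
theorem mulVec_eq_zero_of_infinityBlock (hE : E.PosSemidef) (hJ : Jᵀ = -J) (hR : R.PosSemidef)
    {t₀ t₁ : Fin n → ℝ} (h0 : E *ᵥ t₀ = 0) (h1 : E *ᵥ t₁ = (J - R) *ᵥ t₀) : R *ᵥ t₀ = 0 := by
  have h2 : t₀ ⬝ᵥ E *ᵥ t₁ = 0 := by
    rw [dotProduct_mulVec_comm, transpose_eq_of_posSemidef hE, h0, dotProduct_zero]
  rw [h1, sub_mulVec, dotProduct_sub, dotProduct_mulVec_self_of_skew hJ] at h2
  exact mulVec_eq_zero_of_quadForm hR (by linarith)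

theorem exists_common_kernel_of_two_le_index (hE : E.PosSemidef) (hJ : Jᵀ = -J)
    (hR : R.PosSemidef) (h : 2 ≤ index (E, J - R)) :
    ∃ v, v ⬝ᵥ v = 1 ∧ E *ᵥ v = 0 ∧ R *ᵥ v = 0 := by
  obtain ⟨t, hne, -, ht0, ht⟩ := (hasInfinityBlock_index (L := (E, J - R)) (by omega)).exists_chain
  have h0 := ht0 ⟨0, by omega⟩ rfl
  have h1 := ht ⟨0, by omega⟩ ⟨1, by omega⟩ rfl
  obtain ⟨c, hc⟩ := exists_unit_smul (hne ⟨0, by omega⟩)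
  refine ⟨_, hc, ?_, ?_⟩
  · rw [mulVec_smul, h0, smul_zero]
  · rw [mulVec_smul, mulVec_eq_zero_of_infinityBlock hE hJ hR h0 h1, smul_zero]

/-- In a chain of length three, pairing `E t₂ = A t₁` with `t₀` and using `R t₀ = 0` makes the
quadratic form of `E` vanish at `t₁`. Then `A t₀ = E t₁ = 0`, which a chain excludes. -/
theorem index_le_two (hE : E.PosSemidef) (hJ : Jᵀ = -J) (hR : R.PosSemidef) :
    index (E, J - R) ≤ 2 := by
  by_contra! h
  obtain ⟨t, -, hne, ht0, ht⟩ := (hasInfinityBlock_index (L := (E, J - R)) (by omega)).exists_chain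
  have h0 := ht0 ⟨0, by omega⟩ rfl
  have h1 := ht ⟨0, by omega⟩ ⟨1, by omega⟩ rfl
  have h2 := ht ⟨1, by omega⟩ ⟨2, by omega⟩ rfl
  have hA := hne ⟨0, by omega⟩
  set t₀ := t ⟨0, by omega⟩
  set t₁ := t ⟨1, by omega⟩
  set t₂ := t ⟨2, by omega⟩
  have hRt := mulVec_eq_zero_of_infinityBlock hE hJ hR h0 h1
  have h3 : t₀ ⬝ᵥ E *ᵥ t₂ = 0 := by
    rw [dotProduct_mulVec_comm, transpose_eq_of_posSemidef hE, h0, dotProduct_zero]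
  have h4 : t₁ ⬝ᵥ E *ᵥ t₁ = 0 := by
    rw [h2, dotProduct_mulVec_comm, transpose_sub, hJ, transpose_eq_of_posSemidef hR,
      sub_mulVec, hRt, neg_mulVec] at h3
    rw [h1, sub_mulVec, hRt]
    simpa using h3
  exact hA (by rw [← h1, mulVec_eq_zero_of_quadForm hE h4])

theorem det_ofReal_map (X : Matrix (Fin n) (Fin n) ℝ) :
    (X.map Complex.ofReal).det = (X.det : ℂ) :=
  (RingHom.map_det Complex.ofRealHom X).symm

theorem isRegular_of_det_sub_ne_zero {A : Matrix (Fin n) (Fin n) ℝ} (h : (E - A).det ≠ 0) :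
    IsRegular (E, A) := by
  refine ⟨1, ?_⟩
  have : (1 : ℂ) • E.map Complex.ofReal - A.map Complex.ofReal = (E - A).map Complex.ofReal := by
    ext; simp
  simp only
  rw [this, det_ofReal_map]
  exact_mod_cast h

theorem isSingular_of_common_kernel {A : Matrix (Fin n) (Fin n) ℝ} {v : Fin n → ℝ} (hv : v ≠ 0)
    (hE : E *ᵥ v = 0) (hA : A *ᵥ v = 0) : IsSingular (E, A) := by
  rintro ⟨z, hz⟩
  refine hz (exists_mulVec_eq_zero_iff.1 ⟨fun i => (v i : ℂ), ?_, ?_⟩)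
  · contrapose! hv
    ext i
    simpa using congrFun hv i
  · have key : ∀ X : Matrix (Fin n) (Fin n) ℝ, X *ᵥ v = 0 →
        X.map Complex.ofReal *ᵥ (fun i => (v i : ℂ)) = 0 := by
      intro X hX
      ext i
      have := congrArg Complex.ofReal (congrFun hX i)
      simpa [mulVec, dotProduct] using this
    rw [sub_mulVec, smul_mulVec, key E hE, key A hA]
    simp

/-- The matrix `E - (J - R)` is singular only if `E`, `J`, `R` have a common kernel vector. -/
theorem mulVec_eq_zero_of_sub (hE : E.PosSemidef) (hJ : Jᵀ = -J) (hR : R.PosSemidef)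
    {x : Fin n → ℝ} (h : (E - (J - R)) *ᵥ x = 0) : E *ᵥ x = 0 ∧ J *ᵥ x = 0 ∧ R *ᵥ x = 0 := by
  have hq := congrArg (fun y => x ⬝ᵥ y) h
  simp only [sub_mulVec, dotProduct_sub, dotProduct_mulVec_self_of_skew hJ, dotProduct_zero] at hq
  have h1 := quadForm_nonneg hE x
  have h2 := quadForm_nonneg hR x
  have hEx := mulVec_eq_zero_of_quadForm hE (x := x) (by linarith)
  have hRx := mulVec_eq_zero_of_quadForm hR (x := x) (by linarith)
  refine ⟨hEx, ?_, hRx⟩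
  simpa [sub_mulVec, hEx, hRx] using h

theorem exists_common_kernel_of_isSingular (hE : E.PosSemidef) (hJ : Jᵀ = -J)
    (hR : R.PosSemidef) (h : IsSingular (E, J - R)) :
    ∃ v, v ⬝ᵥ v = 1 ∧ E *ᵥ v = 0 ∧ J *ᵥ v = 0 ∧ R *ᵥ v = 0 := by
  have hdet : (E - (J - R)).det = 0 := by
    by_contra hne
    exact h (isRegular_of_det_sub_ne_zero hne)
  obtain ⟨x, hx, hx0⟩ := exists_mulVec_eq_zero_iff.2 hdet
  obtain ⟨h1, h2, h3⟩ := mulVec_eq_zero_of_sub hE hJ hR hx0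
  obtain ⟨c, hc⟩ := exists_unit_smul hx
  exact ⟨_, hc, by rw [mulVec_smul, h1, smul_zero], by rw [mulVec_smul, h2, smul_zero],
    by rw [mulVec_smul, h3, smul_zero]⟩

/-- If the kernel of `E` is spanned by `v`, `R v = 0` and `J v ≠ 0`, the pencil is regular of
index two. -/
theorem isRegular_and_index_eq_two (hn : 2 ≤ n) (hE : E.PosSemidef) (hJ : Jᵀ = -J)
    (hR : R.PosSemidef) {v : Fin n → ℝ} (hv : v ⬝ᵥ v = 1) (hEv : E *ᵥ v = 0)
    (hker : ∀ x, E *ᵥ x = 0 → v ⬝ᵥ x = 0 → x = 0) (hRv : R *ᵥ v = 0) (hJv : J *ᵥ v ≠ 0) :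
    IsRegular (E, J - R) ∧ index (E, J - R) = 2 := by
  have hEs := transpose_eq_of_posSemidef hE
  have hvE : ∀ x, v ⬝ᵥ E *ᵥ x = 0 := fun x => by
    rw [dotProduct_mulVec_comm, hEs, hEv, dotProduct_zero]
  constructor
  · refine isRegular_of_det_sub_ne_zero fun hdet => ?_
    obtain ⟨x, hx, hx0⟩ := exists_mulVec_eq_zero_iff.2 hdet
    obtain ⟨h1, h2, -⟩ := mulVec_eq_zero_of_sub hE hJ hR hx0
    have hxv : x = (v ⬝ᵥ x) • v := by
      rw [← sub_eq_zero]
      refine hker _ ?_ ?_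
      · rw [mulVec_sub, mulVec_smul, h1, hEv, smul_zero, sub_zero]
      · rw [dotProduct_sub, dotProduct_smul, hv]; simp
    rw [hxv, mulVec_smul] at h2
    rcases smul_eq_zero.1 h2 with h | h
    · exact hx (by rw [hxv, h, zero_smul])
    · exact hJv h
  · refine le_antisymm (index_le_two hE hJ hR) (HasInfinityBlock.le_index ?_)
    set w := J *ᵥ v with hw
    have hvw : v ⬝ᵥ w = 0 := dotProduct_mulVec_self_of_skew hJ v
    obtain ⟨u, hu⟩ : ∃ u, E *ᵥ u = w := by
      -- `Jv` is orthogonal to `v`, so it should lie in the range of `E`. The rank-one shift is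
      -- invertible, and pairing its solution `u` with `v` gives `v ⬝ᵥ u = 0`, so the shift has no
      -- effect on `u`.
      have hdet : IsUnit (E + vecMulVec v v) := by
        rw [isUnit_iff_isUnit_det, isUnit_iff_ne_zero]
        intro hdet
        obtain ⟨x, hx, hx0⟩ := exists_mulVec_eq_zero_iff.2 hdet
        rw [add_mulVec, vecMulVec_mulVec] at hx0
        have h1 := congrArg (fun y => v ⬝ᵥ y) hx0
        simp [dotProduct_add, hvE, hv] at h1
        refine hx (hker x ?_ h1)
        simpa [h1] using hx0
      obtain ⟨u, hu⟩ := mulVec_surjective_iff_isUnit.2 hdet w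
      simp only [add_mulVec, vecMulVec_mulVec] at hu
      have h1 := congrArg (fun y => v ⬝ᵥ y) hu
      simp [dotProduct_add, hvE, hv, hvw] at h1
      exact ⟨u, by simpa [h1] using hu⟩
    set g := u ⬝ᵥ w with hg
    have hg0 : g ≠ 0 := by
      intro h
      rw [hg, ← hu] at h
      exact hJv (by rw [← hu, mulVec_eq_zero_of_quadForm hE h])
    have hAv : (J - R) *ᵥ v = w := by rw [sub_mulVec, hRv, sub_zero]
    have hvA : v ᵥ* (J - R) = -w := by
      rw [← mulVec_transpose, transpose_sub, hJ, transpose_eq_of_posSemidef hR, sub_mulVec,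
        neg_mulVec, hRv, sub_zero]
    have huE : u ᵥ* E = w := by rw [← mulVec_transpose, hEs, hu]
    have hvE' : v ᵥ* E = 0 := by rw [← mulVec_transpose, hEs, hEv]
    have hvAu : v ⬝ᵥ (J - R) *ᵥ u = -g := by
      rw [dotProduct_mulVec, hvA, neg_dotProduct, dotProduct_comm]
    set q := u ⬝ᵥ (J - R) *ᵥ u with hq
    -- The right chain is `v, u`. The left chain is the same up to order and scaling by `±g⁻¹`; the
    -- extra multiple of `v` cancels the pairing `q` of `u` with itself under `J - R`.
    refine hasInfinityBlock_two hn ![g⁻¹ • u + (q * g⁻¹ * g⁻¹) • v, -g⁻¹ • v] ![v, u] ?_ ?_ ?_ ?_ ?_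
    · intro i j
      fin_cases i <;> fin_cases j
      · simp [add_dotProduct, hAv, hvw, ← hg, hg0]
      · simp only [Fin.zero_eta, Fin.mk_one, cons_val_zero, cons_val_one, add_dotProduct,
          smul_dotProduct, hvAu, ← hq, smul_eq_mul]
        field_simp
        simp
      · simp [hAv, hvw]
      · simp [hvAu, hg0]
    · simpa using hEv
    · simp [hAv, hu]
    · simp [neg_vecMul, smul_vecMul, hvE']
    · simp [add_vecMul, neg_vecMul, smul_vecMul, hvE', huE, hvA]

end DissipativeHamiltonian

/-! ### Approximation by regular pencils of index two. -/

section Closure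

variable {n : ℕ} {E J R : Matrix (Fin n) (Fin n) ℝ}

theorem posSemidef_one_sub_vecMulVec {v : Fin n → ℝ} (hv : v ⬝ᵥ v = 1) :
    (1 - vecMulVec v v).PosSemidef := by
  have h : (1 - vecMulVec v v)ᴴ * (1 - vecMulVec v v) = 1 - vecMulVec v v := by
    have h1 : (vecMulVec v v)ᴴ = vecMulVec v v := by
      ext i j; simp [vecMulVec_apply, mul_comm]
    have h2 : vecMulVec v v * vecMulVec v v = vecMulVec v v := by
      rw [vecMulVec_mul_vecMulVec, hv]; simp
    rw [conjTranspose_sub, conjTranspose_one, h1, Matrix.sub_mul, Matrix.mul_sub,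
      Matrix.mul_sub, h2]
    simp
  rw [← h]
  exact posSemidef_conjTranspose_mul_self _

theorem transpose_vecMulVec_sub (v y : Fin n → ℝ) :
    (vecMulVec y v - vecMulVec v y)ᵀ = -(vecMulVec y v - vecMulVec v y) := by
  ext i j
  simp [vecMulVec_apply, mul_comm]

theorem vecMulVec_sub_mulVec {v y : Fin n → ℝ} (hv : v ⬝ᵥ v = 1) (hvy : v ⬝ᵥ y = 0) :
    (vecMulVec y v - vecMulVec v y) *ᵥ v = y := by
  rw [sub_mulVec, vecMulVec_mulVec, vecMulVec_mulVec, hv, dotProduct_comm y, hvy]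
  simp

theorem exists_ne_zero_orthogonal (hn : 2 ≤ n) (v : Fin n → ℝ) : ∃ y, y ≠ 0 ∧ v ⬝ᵥ y = 0 := by
  have h : LinearMap.ker (dotProductBilin ℝ ℝ v) ≠ ⊥ :=
    LinearMap.ker_ne_bot_of_finrank_lt (by simp; omega)
  obtain ⟨y, hy, hy0⟩ := Submodule.exists_mem_ne_zero_of_ne_bot h
  exact ⟨y, hy0, hy⟩

/-- A dH pencil for which `E` and `R` have a common kernel is a limit of regular dH pencils of
index two. -/
theorem mem_closure_of_common_kernel (hn : 2 ≤ n) (hE : E.PosSemidef) (hJ : Jᵀ = -J)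
    (hR : R.PosSemidef) {v : Fin n → ℝ} (hv : v ⬝ᵥ v = 1) (hEv : E *ᵥ v = 0)
    (hRv : R *ᵥ v = 0) :
    (E, J - R) ∈ closure {L : Pencil n | L ∈ dH n ∧ IsRegular L ∧ index L = 2} := by
  -- With `Jv` a nonnegative multiple of `y`, the perturbed `J` sends `v` to `(c + ε) y`, nonzero
  -- for every `ε > 0`. If `Jv = 0`, any nonzero `y` orthogonal to `v` serves, which needs `2 ≤ n`.
  obtain ⟨y, c, hy, hvy, hc, hJv⟩ :
      ∃ (y : Fin n → ℝ) (c : ℝ), y ≠ 0 ∧ v ⬝ᵥ y = 0 ∧ 0 ≤ c ∧ J *ᵥ v = c • y := by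
    by_cases h : J *ᵥ v = 0
    · obtain ⟨y, hy, hvy⟩ := exists_ne_zero_orthogonal hn v
      exact ⟨y, 0, hy, hvy, le_rfl, by rw [h, zero_smul]⟩
    · exact ⟨J *ᵥ v, 1, h, dotProduct_mulVec_self_of_skew hJ v, zero_le_one, by rw [one_smul]⟩
  -- Adding `ε` times the projection onto the complement of `v` shrinks the kernel of `E` to the
  -- line of `v`.
  let f : ℝ → Pencil n := fun ε =>
    (E + ε • (1 - vecMulVec v v), (J + ε • (vecMulVec y v - vecMulVec v y)) - R)
  have hf : Continuous f := by fun_prop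
  have hf0 : f 0 = (E, J - R) := by simp [f]
  have ht : Tendsto f (𝓝[>] 0) (𝓝 (E, J - R)) := by
    rw [← hf0]
    exact hf.continuousAt.mono_left nhdsWithin_le_nhds
  refine mem_closure_of_tendsto ht ?_
  filter_upwards [self_mem_nhdsWithin] with ε hε
  have hε : 0 < ε := hε
  have hE' : (E + ε • (1 - vecMulVec v v)).PosSemidef :=
    hE.add ((posSemidef_one_sub_vecMulVec hv).smul hε.le)
  have hJ' : (J + ε • (vecMulVec y v - vecMulVec v y))ᵀ =
      -(J + ε • (vecMulVec y v - vecMulVec v y)) := by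
    rw [transpose_add, transpose_smul, transpose_vecMulVec_sub, hJ, smul_neg, neg_add]
  have hmul : ∀ x, (E + ε • (1 - vecMulVec v v)) *ᵥ x = E *ᵥ x + ε • (x - (v ⬝ᵥ x) • v) := by
    intro x
    simp [add_mulVec, smul_mulVec, sub_mulVec, vecMulVec_mulVec]
  refine ⟨⟨_, _, R, hE', hJ', hR, rfl⟩,
    isRegular_and_index_eq_two hn hE' hJ' hR hv ?_ ?_ hRv ?_⟩
  · simp [hmul, hEv, hv]
  · intro x hx hvx
    rw [hmul, hvx, zero_smul, sub_zero] at hx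
    have h1 := congrArg (fun z => x ⬝ᵥ z) hx
    simp only [dotProduct_add, dotProduct_smul, smul_eq_mul, dotProduct_zero] at h1
    have h2 := quadForm_nonneg hE x
    have h3 : 0 ≤ x ⬝ᵥ x := by simpa using dotProduct_star_self_nonneg x
    refine dotProduct_self_eq_zero.1 (le_antisymm ?_ h3)
    by_contra! h4
    nlinarith [mul_pos hε h4]
  · rw [add_mulVec, smul_mulVec, vecMulVec_sub_mulVec hv hvy, hJv, ← add_smul]
    exact smul_ne_zero (by positivity) hy

end Closure

/-! ### Frobenius costs of skew perturbations, and spectral bounds. -/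

section Frobenius

variable {n : ℕ}

/-- The squared Frobenius norm of a matrix. -/
def frobSq (X : Matrix (Fin n) (Fin n) ℝ) : ℝ := ∑ i, ∑ j, X i j ^ 2

theorem frobSq_nonneg (X : Matrix (Fin n) (Fin n) ℝ) : 0 ≤ frobSq X :=
  Finset.sum_nonneg fun _ _ => Finset.sum_nonneg fun _ _ => sq_nonneg _

theorem frobNorm_nonneg (D : Pencil n) : 0 ≤ frobNorm D := Real.sqrt_nonneg _

theorem frobNorm_sq (D : Pencil n) : frobNorm D ^ 2 = frobSq D.1 + frobSq D.2 :=
  Real.sq_sqrt (add_nonneg (frobSq_nonneg D.1) (frobSq_nonneg D.2))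

theorem frobSq_sub (X Y : Matrix (Fin n) (Fin n) ℝ) :
    frobSq (X - Y) = frobSq X - 2 * ∑ i, ∑ j, X i j * Y i j + frobSq Y := by
  simp only [frobSq, Finset.mul_sum, ← Finset.sum_sub_distrib, ← Finset.sum_add_distrib]
  refine Finset.sum_congr rfl fun i _ => Finset.sum_congr rfl fun j _ => ?_
  rw [Matrix.sub_apply]
  ring

/-- Transposing the double sum changes the sign of the inner product of `K` and `S`, so it is zero.
Hence changes of `J` and of `R` are charged separately. -/
theorem frobSq_sub_of_skew_of_symm {K S : Matrix (Fin n) (Fin n) ℝ} (hK : Kᵀ = -K)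
    (hS : Sᵀ = S) : frobSq (K - S) = frobSq K + frobSq S := by
  have h : ∑ i, ∑ j, K i j * S i j = -∑ i, ∑ j, K i j * S i j := by
    conv_lhs => rw [Finset.sum_comm]
    simp only [← Finset.sum_neg_distrib]
    refine Finset.sum_congr rfl fun i _ => Finset.sum_congr rfl fun j _ => ?_
    have h1 : K j i = -K i j := congrFun (congrFun hK i) j
    have h2 : S j i = S i j := congrFun (congrFun hS i) j
    rw [h1, h2, neg_mul]
  rw [frobSq_sub]
  linarith

theorem sum_mul_vecMulVec_sub (X : Matrix (Fin n) (Fin n) ℝ) (v w : Fin n → ℝ) :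
    ∑ i, ∑ j, X i j * (vecMulVec w v - vecMulVec v w) i j = w ⬝ᵥ X *ᵥ v - v ⬝ᵥ X *ᵥ w := by
  simp only [dotProduct, mulVec, Finset.mul_sum, ← Finset.sum_sub_distrib]
  refine Finset.sum_congr rfl fun i _ => Finset.sum_congr rfl fun j _ => ?_
  simp only [Matrix.sub_apply, vecMulVec_apply]
  ring

theorem frobSq_vecMulVec_sub {v w : Fin n → ℝ} (hv : v ⬝ᵥ v = 1) (hvw : v ⬝ᵥ w = 0) :
    frobSq (vecMulVec w v - vecMulVec v w) = 2 * (w ⬝ᵥ w) := by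
  have h := sum_mul_vecMulVec_sub (vecMulVec w v - vecMulVec v w) v w
  rw [vecMulVec_sub_mulVec hv hvw, sub_mulVec, vecMulVec_mulVec, vecMulVec_mulVec, hvw] at h
  simp only [← sq] at h
  rw [frobSq, h]
  simp [hv]
  ring

/-- A skew-symmetric matrix that maps the unit vector `v` to `w` has squared Frobenius norm at
least `2 ‖w‖²`. -/
theorem two_mul_dotProduct_mulVec_le_frobSq {K : Matrix (Fin n) (Fin n) ℝ} (hK : Kᵀ = -K)
    {v : Fin n → ℝ} (hv : v ⬝ᵥ v = 1) : 2 * (K *ᵥ v ⬝ᵥ K *ᵥ v) ≤ frobSq K := by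
  have hvw := dotProduct_mulVec_self_of_skew hK v
  -- With `w = Kv`, the inner product of `K` with the rank-two matrix and the squared norm of that
  -- matrix are both `2‖w‖²`: the difference is the remainder of an orthogonal projection.
  have h1 := frobSq_nonneg (K - (vecMulVec (K *ᵥ v) v - vecMulVec v (K *ᵥ v)))
  rw [frobSq_sub, sum_mul_vecMulVec_sub, frobSq_vecMulVec_sub hv hvw,
    dotProduct_mulVec_comm K v, hK, neg_mulVec, dotProduct_neg] at h1
  linarith

/-- Shifting `X` by `lambdaMin X` leaves a nonnegative spectrum, hence a positive semidefinite
matrix. Finiteness of the spectrum makes the infimum a true lower bound. -/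
theorem lambdaMin_le_quadForm {X : Matrix (Fin n) (Fin n) ℝ} (hX : Xᵀ = X) {v : Fin n → ℝ}
    (hv : v ⬝ᵥ v = 1) : lambdaMin X ≤ v ⬝ᵥ X *ᵥ v := by
  have hbdd : BddBelow (spectrum ℝ X) := (Matrix.finite_real_spectrum (A := X)).bddBelow
  have hps : (X - algebraMap ℝ (Matrix (Fin n) (Fin n) ℝ) (lambdaMin X)).PosSemidef := by
    rw [posSemidef_iff_isHermitian_and_spectrum_nonneg]
    constructor
    · rw [IsHermitian, conjTranspose_eq_transpose_of_trivial, transpose_sub, hX,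
        algebraMap_eq_diagonal, diagonal_transpose]
    · rw [← spectrum.sub_singleton_eq]
      rintro _ ⟨μ, hμ, _, rfl, rfl⟩
      exact sub_nonneg.2 (csInf_le hbdd hμ)
  have h := quadForm_nonneg hps v
  rw [Algebra.algebraMap_eq_smul_one, sub_mulVec, smul_mulVec, one_mulVec, dotProduct_sub,
    dotProduct_smul, hv] at h
  simpa using h

theorem lambdaMin_neg_sq_le {J : Matrix (Fin n) (Fin n) ℝ} (hJ : Jᵀ = -J) {v : Fin n → ℝ}
    (hv : v ⬝ᵥ v = 1) : lambdaMin (-J ^ 2) ≤ J *ᵥ v ⬝ᵥ J *ᵥ v := by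
  refine (lambdaMin_le_quadForm (by rw [transpose_neg, transpose_pow, hJ, neg_sq]) hv).trans_eq ?_
  rw [sq, neg_mulVec, ← mulVec_mulVec, dotProduct_neg, dotProduct_mulVec_comm, hJ, neg_mulVec,
    dotProduct_neg, neg_neg]

theorem dotProduct_mulVec_self_le_specNorm (J : Matrix (Fin n) (Fin n) ℝ) {v : Fin n → ℝ}
    (hv : v ⬝ᵥ v = 1) : J *ᵥ v ⬝ᵥ J *ᵥ v ≤ specNorm J ^ 2 := by
  have hnorm : ∀ x : Fin n → ℝ, ‖WithLp.toLp 2 x‖ ^ 2 = x ⬝ᵥ x := fun x => by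
    rw [EuclideanSpace.norm_sq_eq]
    simp [dotProduct, sq]
  have h := (toEuclideanCLM (𝕜 := ℝ) (n := Fin n) J).le_opNorm (WithLp.toLp 2 v)
  have h1 : ‖WithLp.toLp 2 v‖ = 1 := by
    rw [← sq_eq_sq₀ (norm_nonneg _) zero_le_one, hnorm, hv, one_pow]
  rw [h1, mul_one, toEuclideanCLM_toLp] at h
  rw [← hnorm]
  exact pow_le_pow_left₀ (norm_nonneg _) h 2

end Frobenius

/-! ### The two distance inequalities. -/

section Distances

variable {n : ℕ} {E J R E₁ J₁ R₁ : Matrix (Fin n) (Fin n) ℝ}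

theorem frobNorm_sub_sq (hJ : Jᵀ = -J) (hR : R.PosSemidef) (hJ₁ : J₁ᵀ = -J₁)
    (hR₁ : R₁.PosSemidef) :
    frobNorm ((E₁, J₁ - R₁) - (E, J - R)) ^ 2 =
      frobSq (E₁ - E) + frobSq (J₁ - J) + frobSq (R₁ - R) := by
  have h : (J₁ - R₁) - (J - R) = (J₁ - J) - (R₁ - R) := by abel
  rw [frobNorm_sq, Prod.fst_sub, Prod.snd_sub, h,
    frobSq_sub_of_skew_of_symm (K := J₁ - J) (S := R₁ - R), add_assoc]
  · rw [transpose_sub, hJ, hJ₁]; abel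
  · rw [transpose_sub, transpose_eq_of_posSemidef hR, transpose_eq_of_posSemidef hR₁]

theorem continuous_frobNorm : Continuous (frobNorm (n := n)) := by
  unfold frobNorm
  fun_prop

theorem distSing_le {L M : Pencil n} (hM : M ∈ dH n) (hs : IsSingular M) :
    distSing L ≤ ENNReal.ofReal (frobNorm (M - L)) :=
  iInf₂_le (M - L) (by rw [add_sub_cancel]; exact ⟨hM, hs⟩)

/-- `M` itself may be singular or of low index; continuity of the norm carries the bound over from
its approximants. -/
theorem distHighIndex_le_of_mem_closure {L M : Pencil n}
    (hM : M ∈ closure {L : Pencil n | L ∈ dH n ∧ IsRegular L ∧ index L = 2}) :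
    distHighIndex L ≤ ENNReal.ofReal (frobNorm (M - L)) := by
  have hcl : IsClosed {M : Pencil n | distHighIndex L ≤ ENNReal.ofReal (frobNorm (M - L))} :=
    isClosed_le continuous_const (ENNReal.continuous_ofReal.comp
      (continuous_frobNorm.comp (continuous_id.sub continuous_const)))
  refine closure_minimal (fun N hN => ?_) hcl hM
  have hN' : L + (N - L) ∈ dH n ∧ 2 ≤ index (L + (N - L)) := by
    rw [add_sub_cancel]
    exact ⟨hN.1, hN.2.2.ge⟩
  change distHighIndex L ≤ _
  exact iInf₂_le (N - L) hN'

/-- Taking square roots reduces this to the universal property of the infimum, including the value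
`∞` of an empty one. -/
theorem le_iInf₂_sq {ι : Type*} {p : ι → Prop} {f : ι → ENNReal} {a : ENNReal}
    (h : ∀ i, p i → a ≤ f i ^ 2) : a ≤ (⨅ (i) (_ : p i), f i) ^ 2 := by
  have ha : (a ^ (2⁻¹ : ℝ)) ^ 2 = a := by
    rw [← ENNReal.rpow_natCast, ← ENNReal.rpow_mul]
    simp
  rw [← ha]
  gcongr
  refine le_iInf₂ fun i hi => ?_
  rw [ENNReal.rpow_inv_le_iff (by norm_num)]
  exact_mod_cast h i hi

theorem ofReal_frobNorm_sq (D : Pencil n) :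
    ENNReal.ofReal (frobNorm D) ^ 2 = ENNReal.ofReal (frobNorm D ^ 2) :=
  (ENNReal.ofReal_pow (frobNorm_nonneg D) 2).symm

theorem two_mul_lambdaMin_add_distHighIndex_sq_le (hn : 2 ≤ n) (hJ : Jᵀ = -J)
    (hR : R.PosSemidef) :
    2 * ENNReal.ofReal (lambdaMin (-J ^ 2)) + distHighIndex (E, J - R) ^ 2 ≤
      distSing (E, J - R) ^ 2 := by
  refine le_iInf₂_sq fun D ⟨⟨E₁, J₁, R₁, hE₁, hJ₁, hR₁, hL⟩, hs⟩ => ?_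
  rw [hL] at hs
  obtain ⟨v, hv, hEv, hJv, hRv⟩ := exists_common_kernel_of_isSingular hE₁ hJ₁ hR₁ hs
  have hD : D = (E₁, J₁ - R₁) - (E, J - R) := by rw [← hL, add_sub_cancel_left]
  -- Restoring the original `J` in the singular competitor keeps `v` in the kernels of `E₁` and `R₁`
  -- and saves the whole cost of `J₁ - J`.
  have hhi := distHighIndex_le_of_mem_closure (L := (E, J - R))
    (mem_closure_of_common_kernel hn hE₁ hJ hR₁ hv hEv hRv)
  have hK : 2 * (J *ᵥ v ⬝ᵥ J *ᵥ v) ≤ frobSq (J₁ - J) := by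
    have h := two_mul_dotProduct_mulVec_le_frobSq (K := J₁ - J)
      (by rw [transpose_sub, hJ, hJ₁]; abel) hv
    simpa [sub_mulVec, hJv] using h
  have h0 : frobSq (J - J) = 0 := by simp [frobSq]
  calc 2 * ENNReal.ofReal (lambdaMin (-J ^ 2)) + distHighIndex (E, J - R) ^ 2
      ≤ ENNReal.ofReal 2 * ENNReal.ofReal (J *ᵥ v ⬝ᵥ J *ᵥ v)
          + ENNReal.ofReal (frobNorm ((E₁, J - R₁) - (E, J - R))) ^ 2 := by
        rw [ENNReal.ofReal_ofNat]
        gcongr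
        exact lambdaMin_neg_sq_le hJ hv
    _ = ENNReal.ofReal (2 * (J *ᵥ v ⬝ᵥ J *ᵥ v) + (frobSq (E₁ - E) + frobSq (R₁ - R))) := by
        rw [ofReal_frobNorm_sq, frobNorm_sub_sq hJ hR hJ hR₁, h0, add_zero,
          ← ENNReal.ofReal_mul zero_le_two, ← ENNReal.ofReal_add]
        · have : 0 ≤ J *ᵥ v ⬝ᵥ J *ᵥ v := by simpa using dotProduct_star_self_nonneg (J *ᵥ v)
          linarith
        · exact add_nonneg (frobSq_nonneg _) (frobSq_nonneg _)
    _ ≤ ENNReal.ofReal (frobNorm D) ^ 2 := by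
        rw [ofReal_frobNorm_sq, hD, frobNorm_sub_sq hJ hR hJ₁ hR₁]
        exact ENNReal.ofReal_le_ofReal (by linarith)

theorem distSing_sq_le (hJ : Jᵀ = -J) (hR : R.PosSemidef) :
    distSing (E, J - R) ^ 2 ≤
      2 * ENNReal.ofReal (specNorm J) ^ 2 + distHighIndex (E, J - R) ^ 2 := by
  -- Truncated subtraction isolates the infimum so that `le_iInf₂_sq` applies.
  rw [← tsub_le_iff_left]
  refine le_iInf₂_sq fun D ⟨⟨E₁, J₁, R₁, hE₁, hJ₁, hR₁, hL⟩, hi⟩ => ?_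
  rw [tsub_le_iff_left]
  rw [hL] at hi
  obtain ⟨v, hv, hEv, hRv⟩ := exists_common_kernel_of_two_le_index hE₁ hJ₁ hR₁ hi
  have hD : D = (E₁, J₁ - R₁) - (E, J - R) := by rw [← hL, add_sub_cancel_left]
  have hvw := dotProduct_mulVec_self_of_skew hJ v
  set w := J *ᵥ v with hw
  -- The competitor's `J₁` is discarded: the original `J` is corrected by the cheapest skew matrix
  -- that makes it kill `v`.
  have hJ₂ : (J - (vecMulVec w v - vecMulVec v w))ᵀ = -(J - (vecMulVec w v - vecMulVec v w)) := by
    rw [transpose_sub, hJ, transpose_vecMulVec_sub, neg_sub_neg, neg_sub]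
  have hv0 : v ≠ 0 := by
    rintro rfl
    simp at hv
  have hsing : IsSingular (E₁, (J - (vecMulVec w v - vecMulVec v w)) - R₁) :=
    isSingular_of_common_kernel hv0 hEv (by
      rw [sub_mulVec, sub_mulVec, vecMulVec_sub_mulVec hv hvw, ← hw, hRv, sub_self, sub_zero])
  have hle := distSing_le (L := (E, J - R)) ⟨_, _, _, hE₁, hJ₂, hR₁, rfl⟩ hsing
  have hK : frobSq (J - (vecMulVec w v - vecMulVec v w) - J) = 2 * (w ⬝ᵥ w) := by
    have : J - (vecMulVec w v - vecMulVec v w) - J = vecMulVec v w - vecMulVec w v := by abel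
    rw [← frobSq_vecMulVec_sub hv hvw, this, frobSq, frobSq]
    refine Finset.sum_congr rfl fun i _ => Finset.sum_congr rfl fun j _ => ?_
    simp only [Matrix.sub_apply]
    ring
  have hspec := dotProduct_mulVec_self_le_specNorm J hv
  have hspec0 : 0 ≤ specNorm J := norm_nonneg _
  calc distSing (E, J - R) ^ 2 ≤ ENNReal.ofReal (frobNorm
        ((E₁, (J - (vecMulVec w v - vecMulVec v w)) - R₁) - (E, J - R))) ^ 2 := by gcongr
    _ ≤ ENNReal.ofReal (2 * specNorm J ^ 2 + frobNorm D ^ 2) := by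
        rw [ofReal_frobNorm_sq, frobNorm_sub_sq hJ hR hJ₂ hR₁, hK, hD,
          frobNorm_sub_sq hJ hR hJ₁ hR₁]
        refine ENNReal.ofReal_le_ofReal ?_
        have := frobSq_nonneg (J₁ - J)
        linarith
    _ = 2 * ENNReal.ofReal (specNorm J) ^ 2 + ENNReal.ofReal (frobNorm D) ^ 2 := by
        rw [ENNReal.ofReal_add (by positivity) (by positivity), ENNReal.ofReal_mul zero_le_two,
          ENNReal.ofReal_ofNat, ENNReal.ofReal_pow hspec0, ofReal_frobNorm_sq]

end Distances

end DHPencil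

theorem corollary4p11 (n : ℕ) (hn : 2 ≤ n) :
    (∀ E J R : Matrix (Fin n) (Fin n) ℝ,
      E.PosSemidef → J.transpose = -J → R.PosSemidef →
        2 * ENNReal.ofReal (DHPencil.lambdaMin (-J ^ 2)) + DHPencil.distHighIndex (E, J - R) ^ 2
            ≤ DHPencil.distSing (E, J - R) ^ 2 ∧
        DHPencil.distSing (E, J - R) ^ 2
            ≤ 2 * ENNReal.ofReal (DHPencil.specNorm J) ^ 2
              + DHPencil.distHighIndex (E, J - R) ^ 2) ∧
    {L : DHPencil.Pencil n | L ∈ DHPencil.dH n ∧ DHPencil.IsSingular L} ⊆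
      closure {L : DHPencil.Pencil n |
        L ∈ DHPencil.dH n ∧ DHPencil.IsRegular L ∧ DHPencil.index L = 2} := by
  refine ⟨fun E J R _ hJ hR => ⟨DHPencil.two_mul_lambdaMin_add_distHighIndex_sq_le hn hJ hR,
    DHPencil.distSing_sq_le hJ hR⟩, ?_⟩
  rintro _ ⟨⟨E, J, R, hE, hJ, hR, rfl⟩, hs⟩
  obtain ⟨v, hv, hEv, -, hRv⟩ := DHPencil.exists_common_kernel_of_isSingular hE hJ hR hs
  exact DHPencil.mem_closure_of_common_kernel hn hE hJ hR hv hEv hRv
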